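/- A topological dynamical system (TDS) $(X,T)$ is a compact metric space $X$ with a homeomorphism $T\colon X\to X$; $\mathcal M(X,T)$ denotes the set of $T$-invariant Borel probability measures on $X$ and $\mathcal M^e(X,T)$ the set of ergodic ones. Entropy means topological entropy. For $\mu\in\mathcal M(X,T)$ let $\mathrm{Spec}(X,\mu,T)$ be the set of $\lambda\in\mathbb C$ with $|\lambda|=1$ for which there is a non-zero $f\in L^2(\mu)$ with $f\circ T=\lambda f$. The system $(X,T)$ has almost countable spectrum if for every $\mu\in\mathcal M(X,T)$, with ergodic decomposition $\mu=\int_{\mathcal M^e(X,T)} m\,d\tau(m)$, there is a countable set $C_\mu$ such that $\mathrm{Spec}(X,m,T)\subset C_\mu$ for $\tau$-almost every $m$. A group extension $\pi\colon(X,T)\to(Y,R)$ is a continuous surjection with $\pi\circ T=R\circ\pi$ for which there is a compact subgroup $K$, in the uniform topology, of the group $\mathrm{Aut}(X,T)$ of homeomorphisms of $X$ commuting with $T$, such that $\{(x,x')\in X\times X:\pi(x)=\pi(x')\}=\{(x,kx):x\in X,\ k\in K\}$. Proposition. Let $\pi\colon(X,T)\to(Y,R)$ be a group extension between two TDSs.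 If $(Y,R)$ has zero entropy and only countably many ergodic measures, then $(X,T)$ has zero entropy and almost countable spectrum. -/

import Mathlib

open MeasureTheory
open scoped ENNReal

namespace SarnakTDS

universe u v

/-! A topological dynamical system is a pair `(X, T)` with `X` a compact metric space and
`T : X ≃ₜ X` a homeomorphism. Measures live on the Borel `σ`-algebra of `X`. -/

section Measures

variable {X : Type u} [TopologicalSpace X] [MeasurableSpace X]

/-- The set `𝓜(X, T)` of `T`-invariant Borel probability measures. -/
def invariantMeasures (T : X ≃ₜ X) : Set (Measure X) :=
  {μ | IsProbabilityMeasure μ ∧ MeasurePreserving T μ μ}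

/-- The set `𝓜ᵉ(X, T)` of ergodic (in particular `T`-invariant) Borel probability measures. -/
def ergodicMeasures (T : X ≃ₜ X) : Set (Measure X) :=
  {μ | IsProbabilityMeasure μ ∧ Ergodic T μ}

/-- `Spec(X, μ, T)`: the `z` in the unit circle for which there is a nonzero `f ∈ L²(μ)` with
`f ∘ T = z f` in `L²(μ)`. (For invariant `μ` the Koopman operator is unitary, so that all its
eigenvalues lie on the unit circle, which stands for `ℝ/ℤ`.) -/
def spec (T : X ≃ₜ X) (μ : Measure X) : Set Circle :=
  {z | ∃ f : Lp ℂ 2 μ, f ≠ 0 ∧ (fun x => f (T x)) =ᵐ[μ] fun x => (z : ℂ) * f x}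

/-- `τ` is the ergodic decomposition of `μ`: a probability measure on the space of ergodic measures
(with its usual `σ`-algebra, generated by the evaluations `m ↦ m s`, `s` Borel) with
`μ = ∫ m dτ(m)`. -/
structure IsErgodicDecomposition (T : X ≃ₜ X) (μ : Measure X)
    (τ : Measure (ergodicMeasures T)) : Prop where
  isProbabilityMeasure : IsProbabilityMeasure τ
  eq_lintegral : ∀ s : Set X, MeasurableSet s → μ s = ∫⁻ m : ergodicMeasures T, (m : Measure X) s ∂τ

/-- The invariant measure `μ` has almost countable spectrum: some countable set contains the
spectrum of almost every measure of the ergodic decomposition of `μ`. -/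
def MeasureHasAlmostCountableSpectrum (T : X ≃ₜ X) (μ : Measure X) : Prop :=
  ∃ C : Set Circle, C.Countable ∧
    ∃ τ : Measure (ergodicMeasures T), IsErgodicDecomposition T μ τ ∧
      ∀ᵐ m : ergodicMeasures T ∂τ, spec T (m : Measure X) ⊆ C

/-- The system `(X, T)` has almost countable spectrum. -/
def HasAlmostCountableSpectrum (T : X ≃ₜ X) : Prop :=
  ∀ μ ∈ invariantMeasures T, MeasureHasAlmostCountableSpectrum T μ

end Measures

/-- `(X, T)` has zero topological entropy. -/
def HasZeroEntropy {X : Type u} [UniformSpace X] (T : X ≃ₜ X) : Prop :=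
  Dynamics.coverEntropy T Set.univ = 0

section Extensions

variable {X : Type u} {Y : Type v} [TopologicalSpace X] [TopologicalSpace Y]

/-- The group `Aut(X, T)` of all homeomorphisms of `X` that commute with `T`. -/
def Aut (T : X ≃ₜ X) : Subgroup (X ≃ₜ X) :=
  Subgroup.centralizer {T}

/-- The uniform topology on `Aut(X, T)`, induced from `C(X, X)`, whose compact-open topology is for
compact metric `X` the topology of uniform convergence. -/
instance instTopologicalSpaceAut (T : X ≃ₜ X) : TopologicalSpace (Aut T) :=
  TopologicalSpace.induced (fun φ => ((φ : X ≃ₜ X) : C(X, X))) inferInstance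

/-- `π` is a factor map from `(X, T)` to `(Y, R)`. -/
structure IsFactorMap (T : X ≃ₜ X) (R : Y ≃ₜ Y) (π : X → Y) : Prop where
  continuous : Continuous π
  surjective : Function.Surjective π
  semiconj : ∀ x, π (T x) = R (π x)

/-- `π : (X, T) → (Y, R)` is a group extension: a factor map whose fibres are the orbits of a
compact subgroup `K` of `Aut(X, T)`. -/
def IsGroupExtension (T : X ≃ₜ X) (R : Y ≃ₜ Y) (π : X → Y) : Prop :=
  IsFactorMap T R π ∧
    ∃ K : Subgroup (Aut T), IsCompact (K : Set (Aut T)) ∧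
      ∀ x x' : X, π x = π x' ↔ ∃ k ∈ K, x' = (k : X ≃ₜ X) x

end Extensions

end SarnakTDS

/-! Entropy: a fibre of `π` is a `K`-orbit. Since `K` is totally bounded in the uniform distance and
commutes with `T`, `M` orbits shadow the fibre at all times, with `M` independent of the time `N`.
By compactness, `M` dynamical balls of length `N` still cover the preimage of a small ball of `Y`.
Cutting time `N * q` into `q` blocks, a cover of `Y` lifts at the cost of a factor `M ^ q`
(`IsDynCoverOf.exists_lift`). Hence `N` times the entropy of `T` at a fixed scale is at most `log
M`, and large `N` forces it to be zero.

Spectrum: ergodic measures `m`, `m'` with the same image in `Y` are translates of each other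
(`IsGroupExtension.exists_map_eq`): generic points of `m` and `m'` can be found in one fibre, and
the group element joining them carries `m` to `m'`. An automorphism sends eigenfunctions to
eigenfunctions, so translates share their spectrum. Each spectrum is countable because `L²` is
separable, so one ergodic measure over each of the countably many images gives a countable set
containing all ergodic spectra. Any ergodic decomposition then serves. Genericity is only needed
along subsequences of times, so the mean ergodic theorem suffices. -/

/-! ### Zero entropy of group extensions -/

section Entropy

open Dynamics Filter Set UniformSpace
open scoped Uniformity Topology SetRel

/-- If every small ball of `Y` has a preimage covered by boundedly many dynamical balls, then
covers of `Y` lift to covers of `X`, each block of length `N` costing a constant factor. -/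
lemma IsDynCoverOf.exists_lift {X Y : Type*} {T : X → X} {R : Y → Y} {π : X → Y}
    (hsemi : Function.Semiconj π T R) {U : SetRel X X} [U.IsSymm] {V : SetRel Y Y}
    [V.IsSymm] {N M : ℕ} (hN : N ≠ 0)
    (hV : ∀ z : Y, ∃ t : Fin M → X, ∀ x, π x ∈ ball z V →
      ∃ i, x ∈ ball (t i) (dynEntourage T U N))
    {q : ℕ} {s : Finset Y} (hs : IsDynCoverOf R univ V (N * q) s) :
    ∃ t : Finset X, IsDynCoverOf T univ (U ○ U) (N * q) t ∧ t.card ≤ s.card * M ^ q := by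
  classical
  choose t ht using hV
  rcases isEmpty_or_nonempty X with hX | hX
  · exact ⟨∅, by simp [IsDynCoverOf, univ_eq_empty_iff.2 hX]⟩
  -- Points following a prescribed itinerary: a centre `p.1` in `Y` and one of `M` balls in each of
  -- the `q` blocks. The centres of successive blocks need not lie on one orbit, so a point of `A p`
  -- itself becomes the new centre, which turns `U` into `U ○ U`.
  let A (p : s × (Fin q → Fin M)) : Set X :=
    {x | ∀ k : Fin q, T^[N * k] x ∈ ball (t (R^[N * k] p.1) (p.2 k)) (dynEntourage T U N)}
  have hA : ∀ p, ∃ y, ∀ x ∈ A p, (x, y) ∈ dynEntourage T (U ○ U) (N * q) := by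
    intro p
    rcases (A p).eq_empty_or_nonempty with h | ⟨y, hy⟩
    · exact ⟨Classical.arbitrary X, by simp [h]⟩
    · refine ⟨y, fun x hx => mem_dynEntourage.2 fun j hj => ?_⟩
      have hjq : j / N < q := Nat.div_lt_of_lt_mul hj
      have hx' := mem_ball_dynEntourage.1 (hx ⟨j / N, hjq⟩) (j % N)
        (Nat.mod_lt _ (Nat.pos_of_ne_zero hN))
      have hy' := mem_ball_dynEntourage.1 (hy ⟨j / N, hjq⟩) (j % N)
        (Nat.mod_lt _ (Nat.pos_of_ne_zero hN))
      simp only [← Function.iterate_add_apply, Nat.mod_add_div] at hx' hy'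
      exact ⟨_, U.symm hx', hy'⟩
  choose c hc using hA
  refine ⟨Finset.univ.image c, fun x _ => ?_, ?_⟩
  · obtain ⟨z, hz, hxz⟩ := hs (mem_univ (π x))
    have key : ∀ k : Fin q, ∃ i, T^[N * k] x ∈
        ball (t (R^[N * k] z) i) (dynEntourage T U N) := by
      intro k
      refine ht _ _ ?_
      have hk : N * (k : ℕ) < N * q := Nat.mul_lt_mul_of_pos_left k.2 (Nat.pos_of_ne_zero hN)
      have := mem_dynEntourage.1 hxz _ hk
      rw [(hsemi.iterate_right (N * k)).eq]
      exact V.symm this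
    choose w hw using key
    exact ⟨c (⟨z, hz⟩, w), by simp, hc (⟨z, hz⟩, w) x hw⟩
  · refine Finset.card_image_le.trans ?_
    simp

/-- A factor map whose fibres are covered, uniformly in time, by boundedly many dynamical balls
does not raise zero entropy. -/
lemma coverEntropyEntourage_le_zero_of_lift {X Y : Type*} [UniformSpace Y] [Nonempty Y] {T : X → X}
    {R : Y → Y} {π : X → Y} (hsemi : Function.Semiconj π T R) (hR : coverEntropy R univ = 0)
    {U : SetRel X X} [U.IsSymm] {M : ℕ}
    (hM : ∀ N : ℕ, ∃ V ∈ 𝓤 Y, ∀ z : Y, ∃ t : Fin M → X, ∀ x, π x ∈ ball z V →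
      ∃ i, x ∈ ball (t i) (dynEntourage T U N)) :
    coverEntropyEntourage T univ (U ○ U) ≤ 0 := by
  have main : ∀ N : ℕ, N ≠ 0 →
      N * coverEntropyEntourage T univ (U ○ U) ≤ ENNReal.log M := by
    intro N hN
    obtain ⟨V', hV', hV'2⟩ := hM N
    obtain ⟨V, hV, hVsymm, hVV'⟩ := symm_of_uniformity hV'
    have hV2 : ∀ z : Y, ∃ t : Fin M → X, ∀ x, π x ∈ ball z V →
        ∃ i, x ∈ ball (t i) (dynEntourage T U N) := fun z => by
      obtain ⟨t, ht⟩ := hV'2 z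
      exact ⟨t, fun x hx => ht x (hVV' hx)⟩
    have monoX : Monotone fun m ↦ (coverMincard T univ (U ○ U) m).toENNReal :=
      fun _ _ h ↦ ENat.toENNReal_mono (coverMincard_monotone_time T univ (U ○ U) h)
    have monoY : Monotone fun m ↦ (coverMincard R univ V m).toENNReal :=
      fun _ _ h ↦ ENat.toENNReal_mono (coverMincard_monotone_time R univ V h)
    have hY : ExpGrowth.expGrowthSup
        (fun q : ℕ => ((coverMincard R univ V (N * q)).toENNReal)) = 0 := by
      rw [monoY.expGrowthSup_comp_mul hN]
      have h0 : coverEntropyEntourage R univ V = 0 :=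
        le_antisymm (hR ▸ coverEntropyEntourage_le_coverEntropy R univ hV)
          (coverEntropyEntourage_nonneg R univ_nonempty V)
      rw [coverEntropyEntourage] at h0
      rw [h0, mul_zero]
    have hle : ∀ q, (coverMincard T univ (U ○ U) (N * q)).toENNReal ≤
        (coverMincard R univ V (N * q)).toENNReal * (M : ℝ≥0∞) ^ q := by
      intro q
      rcases eq_top_or_lt_top (coverMincard R univ V (N * q)) with h | h
      -- With no finite cover of `Y` the right side is infinite, unless the product is `∞ * 0`; but
      -- no balls at all means that `X` is empty.
      · rcases Nat.eq_zero_or_pos (M ^ q) with hMq | hMq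
        · have hX : IsEmpty X := by
            by_contra hX
            rw [not_isEmpty_iff] at hX
            obtain ⟨x⟩ := hX
            obtain ⟨t, ht⟩ := hV2 (π x)
            obtain ⟨i, _⟩ := ht x (mem_ball_self _ hV)
            exact (Nat.ne_of_gt (Nat.pow_pos i.pos)) hMq
          simp [univ_eq_empty_iff.2 hX]
        · rw [h, ENat.toENNReal_top, ENNReal.top_mul (by exact_mod_cast hMq.ne')]
          exact le_top
      · obtain ⟨s, hs, hcard⟩ := (coverMincard_finite_iff R univ V (N * q)).1 h
        obtain ⟨t, ht, htc⟩ := IsDynCoverOf.exists_lift hsemi hN hV2 hs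
        rw [← hcard]
        calc (coverMincard T univ (U ○ U) (N * q)).toENNReal ≤ ((t.card : ℕ∞)).toENNReal :=
              ENat.toENNReal_mono ht.coverMincard_le_card
          _ ≤ _ := by
              simp only [ENat.toENNReal_coe]
              exact_mod_cast htc
    calc N * coverEntropyEntourage T univ (U ○ U)
        = ExpGrowth.expGrowthSup
          (fun q : ℕ => (coverMincard T univ (U ○ U) (N * q)).toENNReal) :=
          (monoX.expGrowthSup_comp_mul hN).symm
      _ ≤ ExpGrowth.expGrowthSup
          ((fun q : ℕ => (coverMincard R univ V (N * q)).toENNReal) *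
            fun q => (M : ℝ≥0∞) ^ q) := ExpGrowth.expGrowthSup_monotone hle
      _ ≤ 0 + ENNReal.log M := by
          refine (ExpGrowth.expGrowthSup_mul_le (Or.inl ?_) (Or.inl ?_)).trans_eq ?_
          · rw [hY]; simp
          · rw [hY]; simp
          · rw [hY, ExpGrowth.expGrowthSup_pow]
      _ = ENNReal.log M := zero_add _
  by_contra! hpos
  set h := coverEntropyEntourage T univ (U ○ U)
  obtain ⟨c, hc0, hch⟩ := EReal.lt_iff_exists_real_btwn.1 hpos
  have hc0' : 0 < c := by exact_mod_cast hc0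
  obtain ⟨N, hN⟩ := exists_nat_gt (Real.log M / c)
  have hM0 : M ≠ 0 := by
    rintro rfl
    have := main 1 one_ne_zero
    simp only [Nat.cast_one, one_mul, Nat.cast_zero, ENNReal.log_zero] at this
    exact absurd (hpos.trans_le this) (by simp)
  have hN' := main (N + 1) N.succ_ne_zero
  have h1 : ((N + 1 : ℕ) : EReal) * (c : EReal) ≤ ENNReal.log M :=
    le_trans (mul_le_mul_of_nonneg_left hch.le (by positivity)) hN'
  have h2 : ENNReal.log (M : ℝ≥0∞) = ((Real.log M : ℝ) : EReal) := by
    rw [ENNReal.log_pos_real (by exact_mod_cast hM0) (by simp)]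
    simp
  rw [h2] at h1
  have h3 : ((N + 1 : ℕ) : ℝ) * c ≤ Real.log M := by exact_mod_cast h1
  rw [div_lt_iff₀ hc0'] at hN
  push_cast at h3
  nlinarith

/-- A compact set of homeomorphisms has a finite net for the uniform distance. -/
lemma exists_uniform_net {X : Type*} [UniformSpace X] [CompactSpace X] (T : X ≃ₜ X)
    {K : Set (SarnakTDS.Aut T)} (hK : IsCompact K) {U : SetRel X X} (hU : U ∈ 𝓤 X) :
    ∃ s : Set (SarnakTDS.Aut T), s.Finite ∧ s ⊆ K ∧
      ∀ k ∈ K, ∃ g ∈ s, ∀ x, ((k : X ≃ₜ X) x, (g : X ≃ₜ X) x) ∈ U := by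
  let F : SarnakTDS.Aut T → C(X, X) := fun φ => ((φ : X ≃ₜ X) : C(X, X))
  have hF : Continuous F := continuous_induced_dom
  have hc : IsCompact (F '' K) := hK.image hF
  have hW : {p : C(X, X) × C(X, X) | ∀ x, (p.1 x, p.2 x) ∈ U} ∈ 𝓤 C(X, X) :=
    ContinuousMap.hasBasis_compactConvergenceUniformity_of_compact.mem_of_mem hU
  obtain ⟨t, htK, htf, hcov⟩ := totallyBounded_iff_subset.1 hc.totallyBounded _ hW
  obtain ⟨s, hsK, hst⟩ := (subset_image_iff).1 htK
  obtain ⟨s', hs's, hs'f, hs't⟩ : ∃ s' ⊆ s, s'.Finite ∧ F '' s' = t := by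
    obtain ⟨u, hus, hu⟩ := exists_subset_bijOn s F
    exact ⟨u, hus, hu.finite_iff_finite.2 (hst ▸ htf), hu.image_eq.trans hst⟩
  refine ⟨s', hs'f, hs's.trans hsK, fun k hk => ?_⟩
  have := hcov (mem_image_of_mem F hk)
  rw [← hs't] at this
  simp only [mem_iUnion, mem_image, exists_prop, exists_exists_and_eq_and] at this
  obtain ⟨g, hg, h⟩ := this
  exact ⟨g, hg, h⟩

lemma SarnakTDS.Aut.apply_iterate {X : Type*} [TopologicalSpace X] {T : X ≃ₜ X}
    (k : SarnakTDS.Aut T) (n : ℕ) (x : X) :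
    (k : X ≃ₜ X) (T^[n] x) = T^[n] ((k : X ≃ₜ X) x) := by
  have h : Function.Commute (k : X ≃ₜ X) T := fun y => by
    have := Subgroup.mem_centralizer_iff.1 k.2 T rfl
    exact (congrArg (fun e : X ≃ₜ X => e y) this).symm
  exact (h.iterate_right n) x

/-- Uniform closeness of two automorphisms persists along whole orbits, because both commute with
`T`; a finite net of `K` thus bounds the number of dynamical balls per fibre independently of time.
-/
theorem IsGroupExtension.hasZeroEntropy {X : Type*} [MetricSpace X] [CompactSpace X]
    {Y : Type*} [MetricSpace Y] [CompactSpace Y] {T : X ≃ₜ X} {R : Y ≃ₜ Y} {π : X → Y}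
    (hπ : SarnakTDS.IsGroupExtension T R π) (hent : SarnakTDS.HasZeroEntropy R) :
    SarnakTDS.HasZeroEntropy T := by
  obtain ⟨⟨hcont, hsurj, hsemi⟩, K, hK, hfib⟩ := hπ
  -- The empty system has cover entropy `⊥`, not `0`.
  have hY : Nonempty Y := by
    by_contra hY
    rw [not_nonempty_iff] at hY
    have : coverEntropy R (univ : Set Y) = 0 := hent
    rw [univ_eq_empty_iff.2 hY, coverEntropy_empty] at this
    simp at this
  have hX : Nonempty X := hY.map fun y => (hsurj y).choose
  refine le_antisymm (iSup₂_le fun U hU => ?_) (coverEntropy_nonneg _ univ_nonempty)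
  obtain ⟨W, hW, hWo, hWsymm, hWU⟩ := comp_open_symm_mem_uniformity_sets hU
  have : SetRel.IsSymm W := hWsymm
  refine (coverEntropyEntourage_antitone T univ hWU).trans ?_
  obtain ⟨s, hsf, hsK, hs⟩ := exists_uniform_net T hK hW
  obtain ⟨M, ⟨e⟩⟩ := @Finite.exists_equiv_fin s hsf
  refine coverEntropyEntourage_le_zero_of_lift (M := M) hsemi hent fun N => ?_
  choose σ hσ using hsurj
  let O (y : Y) : Set X :=
    ⋃ i : Fin M, ball (((e.symm i : SarnakTDS.Aut T) : X ≃ₜ X) (σ y)) (dynEntourage T W N)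
  have hO : ∀ y, IsOpen (O y) := fun y => isOpen_iUnion fun i =>
    isOpen_ball _ (_root_.isOpen.dynEntourage T.continuous hWo N)
  have hfibO : ∀ y, π ⁻¹' {y} ⊆ O y := by
    intro y x hx
    obtain ⟨k, hk, rfl⟩ := (hfib (σ y) x).1 (by rw [hσ]; exact hx.symm)
    obtain ⟨g, hg, h⟩ := hs k hk
    refine mem_iUnion.2 ⟨e ⟨g, hg⟩, mem_ball_dynEntourage.2 fun j _ => ?_⟩
    simp only [Equiv.symm_apply_apply]
    rw [← SarnakTDS.Aut.apply_iterate, ← SarnakTDS.Aut.apply_iterate]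
    exact SetRel.symm W (h _)
  -- Tube argument: `π` is closed, so an open set containing a fibre contains the preimage of a
  -- neighbourhood.
  have hnhds : ∀ y ∈ (univ : Set Y), (π '' (O y)ᶜ)ᶜ ∈ 𝓝 y := by
    intro y _
    refine ((hcont.isClosedMap _ (hO y).isClosed_compl).isOpen_compl).mem_nhds ?_
    rintro ⟨x, hx, hxy⟩
    exact hx (hfibO y hxy)
  obtain ⟨V, hV, hVy⟩ := lebesgue_number_lemma_nhds isCompact_univ hnhds
  refine ⟨V, hV, fun z => ?_⟩
  obtain ⟨y, hy⟩ := hVy z (mem_univ z)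
  refine ⟨fun i => ((e.symm i : SarnakTDS.Aut T) : X ≃ₜ X) (σ y), fun x hx => ?_⟩
  have hxO : x ∈ O y := by
    by_contra hxO
    exact hy hx ⟨x, hxO, rfl⟩
  exact mem_iUnion.1 hxO

end Entropy

/-! ### Generic points and the mean ergodic theorem -/

section Generic

open Filter Set ProbabilityTheory MeasurableSpace TopologicalSpace
open scoped Topology

lemma ext_of_forall_integral_continuousMap {X : Type*} [MetricSpace X] [MeasurableSpace X]
    [BorelSpace X] {μ ν : Measure X} [IsFiniteMeasure μ]
    [IsFiniteMeasure ν] (h : ∀ f : C(X, ℝ), ∫ x, f x ∂μ = ∫ x, f x ∂ν) : μ = ν :=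
  ext_of_forall_integral_eq_of_IsFiniteMeasure fun f => h f.toContinuousMap

/-- The point `x` is generic for `m` along the times `φ`: the averages over the orbit of `x`, at the
times `φ n`, converge weakly to `m`. -/
def IsGenericAlong {X : Type*} [TopologicalSpace X] [MeasurableSpace X] (T : X → X) (φ : ℕ → ℕ)
    (m : Measure X) (x : X) : Prop :=
  ∀ f : C(X, ℝ), Tendsto (fun n => birkhoffAverage ℝ T f (φ n) x) atTop (𝓝 (∫ y, f y ∂m))

lemma IsGenericAlong.comp {X : Type*} [TopologicalSpace X] [MeasurableSpace X] {T : X → X} {φ : ℕ → ℕ}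
    {m : Measure X} {x : X} (h : IsGenericAlong T φ m x) {θ : ℕ → ℕ} (hθ : Tendsto θ atTop atTop) :
    IsGenericAlong T (φ ∘ θ) m x := fun f => (h f).comp hθ

lemma continuous_birkhoffAverage {X : Type*} [TopologicalSpace X] {T : X → X} (hT : Continuous T) (f : C(X, ℝ))
    (n : ℕ) :
    Continuous (birkhoffAverage ℝ T f n) := by
  refine Continuous.const_smul ?_ (n : ℝ)⁻¹
  exact (continuous_finsetSum _ fun k _ => f.continuous.comp (hT.iterate k))

variable {X : Type*} [MetricSpace X] [CompactSpace X]

lemma norm_birkhoffAverage_le (T : X → X) (f : C(X, ℝ)) (n : ℕ) (x : X) :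
    ‖birkhoffAverage ℝ T f n x‖ ≤ ‖f‖ := by
  rcases eq_or_ne n 0 with rfl | hn
  · simp
  · rw [birkhoffAverage, birkhoffSum, norm_smul, norm_inv, Real.norm_natCast,
      inv_mul_le_iff₀ (by positivity)]
    refine (norm_sum_le _ _).trans ((Finset.sum_le_card_nsmul _ _ ‖f‖ fun k _ =>
      f.norm_coe_le_norm _).trans_eq ?_)
    simp

lemma tendsto_birkhoffAverage_apply_iff {T : X → X} (f : C(X, ℝ)) {φ : ℕ → ℕ}
    (hφ : Tendsto φ atTop atTop) (x : X) (l : ℝ) :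
    Tendsto (fun n => birkhoffAverage ℝ T f (φ n) (T x)) atTop (𝓝 l) ↔
      Tendsto (fun n => birkhoffAverage ℝ T f (φ n) x) atTop (𝓝 l) := by
  have h := (tendsto_birkhoffAverage_apply_sub_birkhoffAverage' ℝ
    (isCompact_range f.continuous).isBounded T x).comp hφ
  constructor
  · intro h'
    simpa using h'.sub h
  · intro h'
    simpa using h'.add h

variable [MeasurableSpace X] [BorelSpace X]

lemma ContinuousMap.integrable_of_compactSpace (f : C(X, ℝ)) (μ : Measure X) [IsFiniteMeasure μ] :
    Integrable f μ :=
  (BoundedContinuousFunction.mkOfCompact f).integrable μ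

lemma integral_birkhoffAverage {T : X → X} (hT : Continuous T) {μ : Measure X} [IsFiniteMeasure μ]
    (hμ : MeasurePreserving T μ μ) (f : C(X, ℝ)) {n : ℕ} (hn : n ≠ 0) :
    ∫ x, birkhoffAverage ℝ T f n x ∂μ = ∫ x, f x ∂μ := by
  have h (k : ℕ) : ∫ x, f (T^[k] x) ∂μ = ∫ x, f x ∂μ := by
    conv_rhs => rw [← (hμ.iterate k).map_eq]
    rw [integral_map (hμ.iterate k).aemeasurable f.continuous.aestronglyMeasurable]
  simp only [birkhoffAverage, birkhoffSum]
  rw [integral_smul, integral_finsetSum]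
  · simp only [h]
    simp [hn]
  · exact fun k _ => (f.comp ⟨_, hT.iterate k⟩).integrable_of_compactSpace μ

/-- The limit of Birkhoff averages has the same integral as the function. -/
lemma integral_eq_of_tendsto_birkhoffAverage {T : X → X} (hT : Continuous T) {μ : Measure X}
    [IsFiniteMeasure μ] (hμ : MeasurePreserving T μ μ) (f : C(X, ℝ)) {φ : ℕ → ℕ}
    (hφ : Tendsto φ atTop atTop) {F : X → ℝ}
    (hF : ∀ᵐ x ∂μ, Tendsto (fun n => birkhoffAverage ℝ T f (φ n) x) atTop (𝓝 (F x))) :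
    ∫ x, F x ∂μ = ∫ x, f x ∂μ := by
  have h1 := tendsto_integral_of_dominated_convergence (fun _ => ‖f‖)
    (fun n => (continuous_birkhoffAverage hT f (φ n)).aestronglyMeasurable)
    (integrable_const _) (fun n => Eventually.of_forall (norm_birkhoffAverage_le T f (φ n))) hF
  refine tendsto_nhds_unique h1 (tendsto_const_nhds.congr' ?_)
  filter_upwards [hφ.eventually_ne_atTop 0] with n hn
  exact (integral_birkhoffAverage hT hμ f hn).symm

/-- Averages and integral are 1-Lipschitz in the function, so the functions for which convergence
holds form a closed set. -/
lemma isGenericAlong_of_denseRange {ι : Type*} {F : ι → C(X, ℝ)} (hF : DenseRange F) {T : X → X}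
    {φ : ℕ → ℕ} {m : Measure X} [IsProbabilityMeasure m] {x : X}
    (h : ∀ i, Tendsto (fun n => birkhoffAverage ℝ T (F i) (φ n) x) atTop (𝓝 (∫ y, F i y ∂m))) :
    IsGenericAlong T φ m x := by
  have hlip : ∀ n, LipschitzWith 1 fun f : C(X, ℝ) => birkhoffAverage ℝ T f (φ n) x := by
    refine fun n => LipschitzWith.of_dist_le_mul fun f g => ?_
    have := norm_birkhoffAverage_le T (f - g) (φ n) x
    rw [ContinuousMap.coe_sub, birkhoffAverage_sub] at this
    simpa [dist_eq_norm] using this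
  have hl : Continuous fun f : C(X, ℝ) => ∫ y, f y ∂m := by
    refine LipschitzWith.continuous (K := 1) (LipschitzWith.of_dist_le_mul fun f g => ?_)
    rw [dist_eq_norm, dist_eq_norm, ← integral_sub (f.integrable_of_compactSpace m)
      (g.integrable_of_compactSpace m)]
    have := norm_integral_le_of_norm_le_const (μ := m)
      (Eventually.of_forall fun y => (f - g).norm_coe_le_norm y)
    simpa using this
  have hclosed := (LipschitzWith.uniformEquicontinuous _ _ hlip).equicontinuous
    |>.isClosed_setOfPred_tendsto (l := atTop) hl
  intro f
  exact hclosed.closure_subset_iff.2 (Set.range_subset_iff.2 h) (hF f)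

lemma IsGenericAlong.measurePreserving {T : X → X} (hT : Continuous T) {φ : ℕ → ℕ}
    (hφ : Tendsto φ atTop atTop) {m : Measure X} [IsProbabilityMeasure m] {x : X}
    (h : IsGenericAlong T φ m x) : MeasurePreserving T m m := by
  refine ⟨hT.measurable, ?_⟩
  have := Measure.isProbabilityMeasure_map (μ := m) hT.measurable.aemeasurable
  refine ext_of_forall_integral_continuousMap fun f => ?_
  rw [integral_map hT.measurable.aemeasurable f.continuous.aestronglyMeasurable]
  refine tendsto_nhds_unique (h (f.comp ⟨T, hT⟩)) ?_
  refine ((tendsto_birkhoffAverage_apply_iff f hφ x _).2 (h f)).congr fun n => ?_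
  simp only [birkhoffAverage, birkhoffSum, ContinuousMap.comp_apply, ContinuousMap.coe_mk,
    ← Function.iterate_succ_apply, ← Function.iterate_succ_apply']

/-- A measure almost all of whose points are generic for it is ergodic. -/
lemma ergodic_of_ae_isGenericAlong {T : X → X} (hT : Continuous T) {φ : ℕ → ℕ}
    (hφ : Tendsto φ atTop atTop) {m : Measure X} [IsProbabilityMeasure m]
    (h : ∀ᵐ x ∂m, IsGenericAlong T φ m x) : Ergodic T m := by
  obtain ⟨x, hx⟩ := h.exists
  have hm := hx.measurePreserving hT hφ
  refine ⟨hm, ⟨fun s hs hTs => ?_⟩⟩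
  have hms : MeasurePreserving T (m.restrict s) (m.restrict s) := by
    simpa only [hTs] using hm.restrict_preimage hs
  -- The restriction to `s` is invariant and its averages tend to the constant `∫ f ∂m`, so its
  -- integral of `f` is `m s` times that constant.
  have heq : m.restrict s = (m s) • m := by
    have : IsFiniteMeasure ((m s) • m) := m.smul_finite (measure_ne_top m s)
    refine ext_of_forall_integral_continuousMap fun f => ?_
    rw [← integral_eq_of_tendsto_birkhoffAverage hT hms f hφ (F := fun _ => ∫ y, f y ∂m)
      (ae_restrict_of_ae (h.mono fun x hx => hx f))]
    simp [measureReal_def]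
  have h0 : m s * m sᶜ = 0 := by
    have := congrArg (fun ν : Measure X => ν sᶜ) heq
    simpa [Measure.restrict_apply hs.compl] using this.symm
  rw [eventuallyConst_set']
  rcases mul_eq_zero.1 h0 with h1 | h1
  · exact Or.inl (ae_eq_empty.2 h1)
  · exact Or.inr (ae_eq_univ.2 h1)

/-- **Mean ergodic theorem**: the Birkhoff averages of a continuous function converge in measure to
its conditional expectation on the invariant sets. -/
lemma tendstoInMeasure_birkhoffAverage {T : X → X} (hT : Continuous T) {μ : Measure X}
    [IsProbabilityMeasure μ] (hμ : MeasurePreserving T μ μ) (f : C(X, ℝ)) :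
    TendstoInMeasure μ (birkhoffAverage ℝ T f) atTop (μ[f | invariants T]) := by
  let U := (Lp.compMeasurePreservingₗᵢ (E := ℝ) (p := 2) ℝ T hμ).toContinuousLinearMap
  let Φ := ContinuousMap.toLp (E := ℝ) 2 μ ℝ
  let c : C(X, ℝ) → C(X, ℝ) := fun g => g.comp ⟨T, hT⟩
  have hc : ∀ n g x, (c^[n] g) x = g (T^[n] x) := by
    intro n
    induction n with
    | zero => simp
    | succ n ih => intro g x; rw [Function.iterate_succ_apply, ih, Function.iterate_succ_apply']; rfl
  have hcU : Function.Semiconj Φ c U := by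
    intro g
    refine Lp.ext ?_
    have h1 : Φ (c g) =ᵐ[μ] c g := ContinuousMap.coeFn_toLp μ (c g)
    have h2 : U (Φ g) =ᵐ[μ] Φ g ∘ T := Lp.coeFn_compMeasurePreserving _ hμ
    have h3 : Φ g ∘ T =ᵐ[μ] g ∘ T :=
      hμ.quasiMeasurePreserving.ae_eq_comp (ContinuousMap.coeFn_toLp μ g)
    exact h1.trans (h2.trans h3).symm
  have hU : ‖U‖ ≤ 1 := LinearIsometry.norm_toContinuousLinearMap_le _
  have hlim := U.tendsto_birkhoffAverage_orthogonalProjection hU (Φ f)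
  set g : Lp ℝ 2 μ := ((U.eqLocus (1 : Lp ℝ 2 μ →L[ℝ] Lp ℝ 2 μ)).orthogonalProjectionOnto (Φ f) :
    Lp ℝ 2 μ)
  have havg : ∀ n, (birkhoffAverage ℝ U _root_.id n (Φ f) : Lp ℝ 2 μ) =ᵐ[μ] birkhoffAverage ℝ T f n := by
    intro n
    have h1 : birkhoffAverage ℝ U _root_.id n (Φ f) = Φ (birkhoffAverage ℝ c _root_.id n f) := by
      rw [map_birkhoffAverage ℝ ℝ Φ]
      simp only [birkhoffAverage, birkhoffSum, _root_.id, Function.comp_apply,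
        fun k => (hcU.iterate_right k).eq f]
    rw [h1]
    refine (ContinuousMap.coeFn_toLp μ _).trans (Eventually.of_forall fun x => ?_)
    simp [birkhoffAverage, birkhoffSum, hc]
  have hmeas : TendstoInMeasure μ (birkhoffAverage ℝ T f) atTop g :=
    (tendstoInMeasure_of_tendsto_Lp hlim).congr_left havg
  obtain ⟨φ, hφ, hφg⟩ := hmeas.exists_seq_tendsto_ae
  refine hmeas.congr_right ?_
  -- This version of the limit is invariant everywhere: `x` and `T x` have the same limits, hence
  -- the same default value where there is none.
  let F : X → ℝ := fun x => limUnder atTop fun n => birkhoffAverage ℝ T f (φ n) x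
  have hFg : g =ᵐ[μ] F := hφg.mono fun x hx => hx.limUnder_eq.symm
  have hφF : ∀ᵐ x ∂μ, Tendsto (fun n => birkhoffAverage ℝ T f (φ n) x) atTop (𝓝 (F x)) := by
    filter_upwards [hφg, hFg] with x h1 h2
    rwa [← h2]
  have hFT : F ∘ T = F := by
    funext x
    simp only [F, Function.comp_apply, limUnder, lim]
    congr 1
    funext l
    exact propext (tendsto_birkhoffAverage_apply_iff f hφ.tendsto_atTop x l)
  have hFm : Measurable F := (StronglyMeasurable.limUnder fun n =>
    (continuous_birkhoffAverage hT f (φ n)).stronglyMeasurable).measurable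
  have hFI : StronglyMeasurable[invariants T] F := Measurable.stronglyMeasurable <|
    measurable_invariants_dom.2 ⟨hFm, fun s _ => by rw [hFT]⟩
  have hFint : Integrable F μ := by
    refine (integrable_const (μ := μ) ‖f‖).mono' hFm.aestronglyMeasurable (hφF.mono fun x hx => ?_)
    exact le_of_tendsto hx.norm (Eventually.of_forall fun n => norm_birkhoffAverage_le T f (φ n) x)
  refine hFg.trans (ae_eq_condExp_of_forall_setIntegral_eq (invariants_le T)
    (f.integrable_of_compactSpace μ) (fun s _ _ => hFint.integrableOn) (fun s hs _ => ?_)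
    hFI.aestronglyMeasurable)
  obtain ⟨hs, hTs⟩ := measurableSet_invariants.1 hs
  have hμs : MeasurePreserving T (μ.restrict s) (μ.restrict s) := by
    simpa only [hTs] using hμ.restrict_preimage hs
  exact integral_eq_of_tendsto_birkhoffAverage hT hμs f hφ.tendsto_atTop (ae_restrict_of_ae hφF)

/-- Countably many sequences that converge in measure converge almost everywhere along a common
subsequence. -/
lemma exists_seq_forall_tendsto_ae {α : Type*} [MeasurableSpace α] {μ : Measure α}
    {u : ℕ → ℕ → α → ℝ} {g : ℕ → α → ℝ} (h : ∀ j, TendstoInMeasure μ (u j) atTop (g j)) :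
    ∃ θ : ℕ → ℕ, StrictMono θ ∧
      ∀ᵐ x ∂μ, ∀ j, Tendsto (fun n => u j (θ n) x) atTop (𝓝 (g j x)) := by
  have hpos : ∀ k : ℕ, (0 : ℝ≥0∞) < 2⁻¹ ^ k := fun k => by simp [ENNReal.pow_pos]
  obtain ⟨θ, hθ, hθP⟩ := extraction_forall_of_eventually
    (P := fun k n => ∀ j ≤ k, μ {x | 2⁻¹ ^ k ≤ edist (u j n x) (g j x)} ≤ 2⁻¹ ^ k) (by
      intro k
      refine (eventually_all_finite (finite_le_nat k)).2 fun j _ => ?_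
      exact ((h j (2⁻¹ ^ k) (hpos k)).eventually_lt_const (hpos k)).mono fun n hn => hn.le)
  refine ⟨θ, hθ, ae_all_iff.2 fun j => ?_⟩
  -- Borel–Cantelli: step `k` of the extraction controls only the sequences of index at most `k`,
  -- which for fixed `j` omits finitely many steps.
  let S : ℕ → Set α := fun k => {x | j ≤ k ∧ 2⁻¹ ^ k ≤ edist (u j (θ k) x) (g j x)}
  have hS : ∑' k, μ (S k) ≠ ∞ := by
    refine ne_top_of_le_ne_top ?_ (ENNReal.tsum_le_tsum (g := fun k => 2⁻¹ ^ k) fun k => ?_)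
    · rw [ENNReal.tsum_geometric]
      simp
    · by_cases hjk : j ≤ k
      · simpa [S, hjk] using hθP k j hjk
      · simp [S, hjk]
  filter_upwards [ae_eventually_notMem hS] with x hx
  rw [tendsto_iff_edist_tendsto_0]
  refine tendsto_of_tendsto_of_tendsto_of_le_of_le' tendsto_const_nhds
    (ENNReal.tendsto_pow_atTop_nhds_zero_of_lt_one (r := 2⁻¹) (by simp))
    (Eventually.of_forall fun _ => zero_le) ?_
  filter_upwards [hx, eventually_ge_atTop j] with k hk hjk
  simp only [S, mem_ofPred_eq, hjk, true_and, not_le] at hk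
  exact hk.le

/-- Along a subsequence of any given sequence of times, almost every point is generic for the
conditional measure of the invariant `σ`-algebra. -/
lemma exists_ae_isGenericAlong_condExpKernel {T : X → X} (hT : Continuous T) {μ : Measure X}
    [IsProbabilityMeasure μ] (hμ : MeasurePreserving T μ μ) {ψ : ℕ → ℕ} (hψ : StrictMono ψ) :
    ∃ θ : ℕ → ℕ, StrictMono θ ∧
      ∀ᵐ x ∂μ, IsGenericAlong T (ψ ∘ θ) (condExpKernel μ (invariants T) x) x := by
  obtain ⟨θ, hθ, h⟩ := exists_seq_forall_tendsto_ae
    (u := fun j n => birkhoffAverage ℝ T (denseSeq C(X, ℝ) j) (ψ n))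
    fun j => (tendstoInMeasure_birkhoffAverage hT hμ (denseSeq C(X, ℝ) j)).comp hψ.tendsto_atTop
  refine ⟨θ, hθ, ?_⟩
  have hκ : ∀ᵐ x ∂μ, ∀ j, (μ[denseSeq C(X, ℝ) j | invariants T]) x =
      ∫ y, denseSeq C(X, ℝ) j y ∂condExpKernel μ (invariants T) x :=
    ae_all_iff.2 fun j => condExp_ae_eq_integral_condExpKernel (invariants_le T)
      ((denseSeq C(X, ℝ) j).integrable_of_compactSpace μ)
  filter_upwards [h, hκ] with x hx hκx
  refine isGenericAlong_of_denseRange (denseRange_denseSeq C(X, ℝ)) fun j => ?_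
  rw [← hκx j]
  exact hx j

/-- Along a subsequence of any given sequence of times, almost every point of an ergodic measure is
generic for it. -/
lemma Ergodic.exists_ae_isGenericAlong {T : X → X} (hT : Continuous T) {μ : Measure X}
    [IsProbabilityMeasure μ] (hμ : Ergodic T μ) {ψ : ℕ → ℕ} (hψ : StrictMono ψ) :
    ∃ θ : ℕ → ℕ, StrictMono θ ∧ ∀ᵐ x ∂μ, IsGenericAlong T (ψ ∘ θ) μ x := by
  obtain ⟨θ, hθ, h⟩ := exists_seq_forall_tendsto_ae
    (u := fun j n => birkhoffAverage ℝ T (denseSeq C(X, ℝ) j) (ψ n))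
    fun j => (tendstoInMeasure_birkhoffAverage hT hμ.toMeasurePreserving
      (denseSeq C(X, ℝ) j)).comp hψ.tendsto_atTop
  refine ⟨θ, hθ, ?_⟩
  have hκ : ∀ᵐ x ∂μ, ∀ j, (μ[denseSeq C(X, ℝ) j | invariants T]) x =
      ∫ y, denseSeq C(X, ℝ) j y ∂μ := by
    refine ae_all_iff.2 fun j => ?_
    have hm := stronglyMeasurable_condExp (μ := μ) (m := invariants T)
      (f := (denseSeq C(X, ℝ) j : X → ℝ))
    obtain ⟨c, hc⟩ := hμ.toPreErgodic.ae_eq_const_of_ae_eq_comp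
      (hm.measurable.mono (invariants_le T) le_rfl)
      (comp_eq_of_measurable_invariants hm.measurable)
    have hi := integral_condExp (μ := μ) (invariants_le T) (f := (denseSeq C(X, ℝ) j : X → ℝ))
    rw [integral_congr_ae hc] at hi
    simp only [Function.const_apply, integral_const, probReal_univ, one_smul] at hi
    rw [← hi]
    exact hc
  filter_upwards [h, hκ] with x hx hκx
  refine isGenericAlong_of_denseRange (denseRange_denseSeq C(X, ℝ)) fun j => ?_
  rw [← hκx j]
  exact hx j

/-! ### Ergodic decomposition -/

/-- A function measurable for `m` is almost surely constant for the conditional measures of `m`. -/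
lemma ae_ae_condExpKernel_eq {Ω : Type*} {m : MeasurableSpace Ω} [mΩ : MeasurableSpace Ω]
    [StandardBorelSpace Ω] {μ : Measure Ω} [IsFiniteMeasure μ] (hm : m ≤ mΩ) {h : Ω → ℝ}
    (hh : Measurable[m] h) : ∀ᵐ x ∂μ, ∀ᵐ y ∂condExpKernel μ m x, h y = h x := by
  have hset : MeasurableSet[m.prod mΩ] {p : Ω × Ω | h p.2 = h p.1} := by
    let _ : MeasurableSpace (Ω × Ω) := m.prod mΩ
    have h1 : Measurable fun p : Ω × Ω => h p.2 :=
      (hh.mono hm le_rfl).comp (@measurable_snd Ω Ω m mΩ)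
    have h2 : Measurable fun p : Ω × Ω => h p.1 := hh.comp (@measurable_fst Ω Ω m mΩ)
    exact measurableSet_eq_fun h1 h2
  have hdiag : @Measurable Ω (Ω × Ω) mΩ (m.prod mΩ) Function.diag :=
    (measurable_id'' hm).prodMk measurable_id
  refine ae_of_ae_trim hm (Measure.ae_ae_of_ae_compProd (p := fun p : Ω × Ω => h p.2 = h p.1) ?_)
  -- The joint law of a point and a sample from its conditional measure is the image of `μ` on the
  -- diagonal.
  rw [compProd_trim_condExpKernel hm]
  exact (@ae_map_iff Ω (Ω × Ω) mΩ (m.prod mΩ) μ _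
    (@Measurable.aemeasurable Ω (Ω × Ω) mΩ (m.prod mΩ) _ μ hdiag) _ hset).2
    (Eventually.of_forall fun x => rfl)

/-- Almost every conditional measure of the invariant `σ`-algebra is ergodic. -/
lemma ae_ergodic_condExpKernel {T : X → X} (hT : Continuous T) {μ : Measure X}
    [IsProbabilityMeasure μ] (hμ : MeasurePreserving T μ μ) :
    ∀ᵐ x ∂μ, Ergodic T (condExpKernel μ (invariants T) x) := by
  obtain ⟨θ, hθ, h⟩ := exists_ae_isGenericAlong_condExpKernel hT hμ strictMono_id
  have h1 : ∀ᵐ x ∂μ, ∀ᵐ y ∂condExpKernel μ (invariants T) x,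
      IsGenericAlong T (id ∘ θ) (condExpKernel μ (invariants T) y) y := by
    refine ae_of_ae_trim (invariants_le T) (Measure.ae_ae_of_ae_comp ?_)
    rwa [condExpKernel_comp_trim]
  -- Almost every `y` drawn from the conditional measure at `x` has that same conditional measure,
  -- as tested on a dense sequence; so its genericity becomes genericity for the measure at `x`.
  have h2 : ∀ᵐ x ∂μ, ∀ j, ∀ᵐ y ∂condExpKernel μ (invariants T) x,
      ∫ z, denseSeq C(X, ℝ) j z ∂condExpKernel μ (invariants T) y =
      ∫ z, denseSeq C(X, ℝ) j z ∂condExpKernel μ (invariants T) x :=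
    ae_all_iff.2 fun j => ae_ae_condExpKernel_eq (invariants_le T)
      (StronglyMeasurable.integral_condExpKernel
        (denseSeq C(X, ℝ) j).continuous.stronglyMeasurable).measurable
  filter_upwards [h1, h2] with x hx1 hx2
  refine ergodic_of_ae_isGenericAlong hT hθ.tendsto_atTop ?_
  filter_upwards [hx1, ae_all_iff.2 hx2] with y hy1 hy2
  refine isGenericAlong_of_denseRange (denseRange_denseSeq C(X, ℝ)) fun j => ?_
  rw [← hy2 j]
  exact hy1 _

/-- **Ergodic decomposition** of an invariant measure. -/
theorem exists_isErgodicDecomposition (T : X ≃ₜ X) {μ : Measure X}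
    (hμ : μ ∈ SarnakTDS.invariantMeasures T) :
    ∃ τ : Measure (SarnakTDS.ergodicMeasures T), SarnakTDS.IsErgodicDecomposition T μ τ := by
  classical
  obtain ⟨hprob, hμ⟩ := hμ
  let κ : X → Measure X := fun x => condExpKernel μ (invariants T) x
  have hκ : ∀ᵐ x ∂μ, Ergodic T (κ x) := ae_ergodic_condExpKernel T.continuous hμ
  obtain ⟨N, hN, hNm, hN0⟩ := exists_measurable_superset_of_null hκ
  have hNκ : ∀ x ∉ N, κ x ∈ SarnakTDS.ergodicMeasures T := fun x hx =>
    ⟨inferInstance, by_contra fun h => hx (hN h)⟩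
  obtain ⟨x₀, hx₀⟩ : ∃ x, x ∉ N := (measure_eq_zero_iff_ae_notMem.1 hN0).exists
  let g : X → SarnakTDS.ergodicMeasures T := fun x =>
    if hx : x ∉ N then ⟨κ x, hNκ x hx⟩ else ⟨κ x₀, hNκ x₀ hx₀⟩
  have hκm : Measurable κ :=
    (Kernel.measurable (condExpKernel μ (invariants T))).mono (invariants_le T) le_rfl
  have hgval : (fun x => (g x : Measure X)) = N.piecewise (fun _ => κ x₀) κ := by
    funext x
    by_cases hx : x ∈ N <;> simp [g, hx]
  have hg : Measurable g := by
    refine measurable_comap_iff.2 ?_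
    change Measurable fun x => (g x : Measure X)
    rw [hgval]
    exact Measurable.piecewise hNm measurable_const hκm
  refine ⟨μ.map g, Measure.isProbabilityMeasure_map hg.aemeasurable, fun s hs => ?_⟩
  have hev : Measurable fun m : SarnakTDS.ergodicMeasures T => (m : Measure X) s :=
    (Measure.measurable_coe hs).comp measurable_subtype_coe
  rw [lintegral_map hev hg]
  have h1 : ∫⁻ x, (g x : Measure X) s ∂μ = ∫⁻ x, κ x s ∂μ := by
    refine lintegral_congr_ae ((measure_eq_zero_iff_ae_notMem.1 hN0).mono fun x hx => ?_)
    simp [g, hx]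
  rw [h1, ← lintegral_trim (invariants_le T) (measurable_condExpKernel hs),
    ← Measure.bind_apply hs (Kernel.aemeasurable _), condExpKernel_comp_trim]

end Generic

/-! ### Spectra of ergodic measures -/

section Spectrum

open Filter Set
open scoped Topology

/-- The spectrum of a factor measure consists of eigenvalues of the measure above. -/
lemma spec_map_subset {X : Type*} [TopologicalSpace X] [MeasurableSpace X] {T : X ≃ₜ X} {m : Measure X}
    (hm : MeasurePreserving T m m) {k : X → X} (hk : Measurable k) (hkT : Function.Commute k T) :
    SarnakTDS.spec T (m.map k) ⊆ SarnakTDS.spec T m := by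
  rintro z ⟨f, hf0, hf⟩
  have hkm : MeasurePreserving k m (m.map k) := hk.measurePreserving m
  have hfk := Lp.coeFn_compMeasurePreserving f hkm
  refine ⟨Lp.compMeasurePreserving k hkm f, fun h => hf0 ?_, ?_⟩
  · rw [← norm_eq_zero, ← Lp.norm_compMeasurePreserving f hkm, h, norm_zero]
  · have h1 := hm.quasiMeasurePreserving.ae_eq_comp hfk
    have h2 := hkm.quasiMeasurePreserving.ae_eq_comp hf
    filter_upwards [hfk, h1, h2] with x hx hx1 hx2
    simp only [Function.comp_apply] at hx hx1 hx2
    rw [hx1, hx, ← hx2, hkT.eq]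

variable {X : Type*} [MetricSpace X] [MeasurableSpace X] [BorelSpace X]

lemma IsGenericAlong.map {T : X → X} {φ : ℕ → ℕ} {m : Measure X} {x : X}
    (h : IsGenericAlong T φ m x) {k : X → X} (hk : Continuous k) (hkT : Function.Commute k T) :
    IsGenericAlong T φ (m.map k) (k x) := by
  intro f
  rw [integral_map hk.measurable.aemeasurable f.continuous.aestronglyMeasurable]
  refine (h (f.comp ⟨k, hk⟩)).congr fun n => ?_
  simp only [birkhoffAverage, birkhoffSum, ContinuousMap.comp_apply, ContinuousMap.coe_mk,
    fun n => (hkT.iterate_right n).eq x]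

lemma IsGenericAlong.unique {T : X → X} {φ : ℕ → ℕ} {m m' : Measure X} [IsFiniteMeasure m]
    [IsFiniteMeasure m'] {x : X} (h : IsGenericAlong T φ m x) (h' : IsGenericAlong T φ m' x) :
    m = m' :=
  ext_of_forall_integral_continuousMap fun f => tendsto_nhds_unique (h f) (h' f)

variable [CompactSpace X]

/-- The spectrum of an invariant measure is countable: eigenfunctions with distinct eigenvalues are
orthogonal and `L²` is separable. -/
lemma countable_spec {T : X ≃ₜ X} {m : Measure X} [IsFiniteMeasure m]
    (hm : MeasurePreserving T m m) : (SarnakTDS.spec T m).Countable := by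
  let U := Lp.compMeasurePreservingₗᵢ (E := ℂ) (p := 2) ℂ T hm
  have hev : ∀ z ∈ SarnakTDS.spec T m, ∃ v : Lp ℂ 2 m, ‖v‖ = 1 ∧ U v = (z : ℂ) • v := by
    rintro z ⟨f, hf0, hf⟩
    have hUf : U f = (z : ℂ) • f := by
      refine Lp.ext ((Lp.coeFn_compMeasurePreserving f hm).trans (hf.trans ?_))
      filter_upwards [Lp.coeFn_smul (z : ℂ) f] with x hx
      rw [hx, Pi.smul_apply, smul_eq_mul]
    exact ⟨((‖f‖⁻¹ : ℝ) : ℂ) • f, by rw [norm_smul]; simp [hf0], by rw [map_smul, hUf, smul_comm]⟩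
  choose! v hv1 hvU using hev
  have horth : ∀ z ∈ SarnakTDS.spec T m, ∀ w ∈ SarnakTDS.spec T m, z ≠ w →
      inner ℂ (v z) (v w) = 0 := by
    intro z hz w hw hzw
    by_contra h
    have h1 := U.inner_map_map (v z) (v w)
    rw [hvU z hz, hvU w hw, inner_smul_left, inner_smul_right, ← mul_assoc,
      mul_eq_right₀ h] at h1
    refine hzw (Circle.ext ?_)
    have h2 : (z : ℂ) * starRingEnd ℂ z = 1 := by
      rw [Complex.mul_conj]; simp
    calc (z : ℂ) = z * (starRingEnd ℂ z * w) := by rw [h1, mul_one]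
      _ = w := by rw [← mul_assoc, h2, one_mul]
  -- Orthonormal vectors are at distance `√2`; the bound `1` already makes the balls of radius `1 /
  -- 2` disjoint.
  have hdist : ∀ z ∈ SarnakTDS.spec T m, ∀ w ∈ SarnakTDS.spec T m, z ≠ w →
      1 ≤ dist (v z) (v w) := by
    intro z hz w hw hzw
    have h := norm_sub_sq (𝕜 := ℂ) (v z) (v w)
    rw [horth z hz w hw hzw, hv1 z hz, hv1 w hw] at h
    rw [dist_eq_norm]
    simp only [map_zero] at h
    nlinarith [norm_nonneg (v z - v w)]
  have : Fact ((2 : ℝ≥0∞) ≠ ∞) := ⟨by simp⟩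
  refine PairwiseDisjoint.countable_of_isOpen (s := fun z => Metric.ball (v z) (1 / 2))
    (fun z hz w hw hzw => Metric.ball_disjoint_ball ?_) (fun z _ => Metric.isOpen_ball)
    fun z _ => Metric.nonempty_ball.2 (by norm_num)
  norm_num
  exact hdist z hz w hw hzw

/-- Compactness makes the image under `π` measurable, and mass above one half makes two such images
meet. -/
lemma exists_isCompact_of_ae {m : Measure X} [IsProbabilityMeasure m] {p : X → Prop}
    (h : ∀ᵐ x ∂m, p x) : ∃ C, IsCompact C ∧ 2⁻¹ < m C ∧ ∀ x ∈ C, p x := by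
  obtain ⟨N, hN, hNm, hN0⟩ := exists_measurable_superset_of_null h
  have h1 : 2⁻¹ < m Nᶜ := by
    rw [(prob_compl_eq_one_iff hNm).2 hN0]
    simp
  obtain ⟨C, hC, hCc, hCm⟩ := hNm.compl.exists_lt_isCompact h1
  exact ⟨C, hCc, hCm, fun x hx => by_contra fun hp => hC hx (hN hp)⟩

variable {Y : Type*} [MetricSpace Y] [MeasurableSpace Y] [BorelSpace Y]

/-- Two ergodic measures on a group extension that have the same image in the factor differ by
an element of the group. -/
theorem IsGroupExtension.exists_map_eq {T : X ≃ₜ X} {R : Y ≃ₜ Y} {π : X → Y}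
    (hπ : SarnakTDS.IsGroupExtension T R π) {m m' : Measure X} (hm : m ∈ SarnakTDS.ergodicMeasures T)
    (hm' : m' ∈ SarnakTDS.ergodicMeasures T) (h : m.map π = m'.map π) :
    ∃ k : SarnakTDS.Aut T, m' = m.map (k : X ≃ₜ X) := by
  obtain ⟨⟨hcont, -, -⟩, K, -, hfib⟩ := hπ
  obtain ⟨_, hm⟩ := hm
  obtain ⟨_, hm'⟩ := hm'
  obtain ⟨θ, hθ, hg⟩ := hm.exists_ae_isGenericAlong T.continuous strictMono_id
  -- Extracting from `θ` makes both measures have generic points along the same times.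
  obtain ⟨θ', hθ', hg'⟩ := hm'.exists_ae_isGenericAlong T.continuous (strictMono_id.comp hθ)
  obtain ⟨C, hC, hmC, hCg⟩ := exists_isCompact_of_ae hg
  obtain ⟨C', hC', hmC', hCg'⟩ := exists_isCompact_of_ae hg'
  have hlarge : ∀ {n : Measure X} {D : Set X}, IsCompact D → 2⁻¹ < n D →
      2⁻¹ < n.map π (π '' D) := by
    intro n D hD hnD
    rw [Measure.map_apply hcont.measurable (hD.image hcont).measurableSet]
    exact hnD.trans_le (measure_mono (subset_preimage_image π D))
  have hne : (π '' C ∩ π '' C').Nonempty := by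
    have : IsProbabilityMeasure (m.map π) :=
      Measure.isProbabilityMeasure_map hcont.measurable.aemeasurable
    refine nonempty_inter_of_measure_lt_add (m.map π) (hC'.image hcont).measurableSet
      (subset_univ _) (subset_univ _) ?_
    rw [measure_univ, ← ENNReal.inv_two_add_inv_two]
    exact ENNReal.add_lt_add (hlarge hC hmC) (h ▸ hlarge hC' hmC')
  obtain ⟨y, ⟨x, hx, rfl⟩, ⟨x', hx', hxx'⟩⟩ := hne
  obtain ⟨k, -, rfl⟩ := (hfib x x').1 hxx'.symm
  have hkT : Function.Commute (k : X ≃ₜ X) T := fun y => SarnakTDS.Aut.apply_iterate k 1 y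
  have := Measure.isProbabilityMeasure_map (μ := m) (k : X ≃ₜ X).continuous.measurable.aemeasurable
  exact ⟨k, (hCg' _ hx').unique
    (((hCg x hx).comp hθ'.tendsto_atTop).map (k : X ≃ₜ X).continuous hkT)⟩

/-- If the factor of a group extension has countably many ergodic measures, then a single countable
set contains the spectra of all ergodic measures of the extension. -/
theorem IsGroupExtension.exists_countable_spec_subset {T : X ≃ₜ X} {R : Y ≃ₜ Y} {π : X → Y}
    (hπ : SarnakTDS.IsGroupExtension T R π) (hR : (SarnakTDS.ergodicMeasures R).Countable) :
    ∃ C : Set Circle, C.Countable ∧ ∀ m ∈ SarnakTDS.ergodicMeasures T, SarnakTDS.spec T m ⊆ C := by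
  have himage : ((fun m : Measure X => m.map π) '' SarnakTDS.ergodicMeasures T).Countable := by
    refine hR.mono ?_
    rintro _ ⟨m, ⟨_, hm⟩, rfl⟩
    have hπm := hπ.1.continuous.measurable
    exact ⟨Measure.isProbabilityMeasure_map hπm.aemeasurable,
      (hπm.measurePreserving m).ergodic_of_ergodic_semiconj hm R.continuous.measurable
        hπ.1.semiconj⟩
  -- `S` picks one ergodic measure of `T` over each image in `Y`.
  obtain ⟨S, hS, hSbij⟩ := exists_subset_bijOn (SarnakTDS.ergodicMeasures T)
    fun m : Measure X => m.map π
  have hSc : S.Countable :=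
    countable_of_injective_of_countable_image hSbij.injOn (hSbij.image_eq ▸ himage)
  refine ⟨⋃ m ∈ S, SarnakTDS.spec T m, hSc.biUnion fun m hm => ?_, fun m hm => ?_⟩
  · obtain ⟨_, h⟩ := hS hm
    exact countable_spec h.toMeasurePreserving
  · obtain ⟨n, hn, hnm⟩ := hSbij.surjOn (mem_image_of_mem _ hm)
    obtain ⟨k, rfl⟩ := IsGroupExtension.exists_map_eq hπ (hS hn) hm hnm
    refine (spec_map_subset (hS hn).2.toMeasurePreserving (k : X ≃ₜ X).continuous.measurable
      fun y => SarnakTDS.Aut.apply_iterate k 1 y).trans (subset_biUnion_of_mem hn)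

end Spectrum

theorem proposition5p1
    {X : Type*} [MetricSpace X] [CompactSpace X] [MeasurableSpace X] [BorelSpace X]
    {Y : Type*} [MetricSpace Y] [CompactSpace Y] [MeasurableSpace Y] [BorelSpace Y]
    (T : X ≃ₜ X) (R : Y ≃ₜ Y) (π : X → Y)
    (hπ : SarnakTDS.IsGroupExtension T R π)
    (hent : SarnakTDS.HasZeroEntropy R)
    (herg : (SarnakTDS.ergodicMeasures R).Countable) :
    SarnakTDS.HasZeroEntropy T ∧ SarnakTDS.HasAlmostCountableSpectrum T := by
  refine ⟨IsGroupExtension.hasZeroEntropy hπ hent, fun μ hμ => ?_⟩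
  obtain ⟨C, hC, hspec⟩ := IsGroupExtension.exists_countable_spec_subset hπ herg
  obtain ⟨τ, hτ⟩ := exists_isErgodicDecomposition T hμ
  exact ⟨C, hC, τ, hτ, Filter.Eventually.of_forall fun m => hspec m m.2⟩
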